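/- Let $H_n=\mathbb C^n\times\mathbb R$ be the Heisenberg group with coordinates $(z,t)$, $z=x+iy$, and multiplication $(x,y,t)\circ(x',y',t')=(x+x',\,y+y',\,t+t'+y\cdot x'-x\cdot y')$. It carries the contact form $\Theta=dt+\sum_\beta (x_\beta\,dy_\beta-y_\beta\,dx_\beta)$, the contact bundle $\xi=\ker\Theta$ framed by the left-invariant fields $\mathring e_\beta=\partial_{x_\beta}+y_\beta\partial_t$ and $\mathring e_{n+\beta}=\partial_{y_\beta}-x_\beta\partial_t$, the CR structure $J\mathring e_\beta=\mathring e_{n+\beta}$, $J\mathring e_{n+\beta}=-\mathring e_\beta$, and the Reeb field $T=\partial_t$. Put $\mathring Z_\beta=\frac12(\mathring e_\beta-i\mathring e_{n+\beta})$; let $\langle\ ,\ \rangle$ be the Levi metric, the Hermitian metric on $\xi_{1,0}$ for which the $\mathring Z_\beta$ are orthonormal, and $\nabla$ the pseudohermitian connection of $H_n$, for which the $\mathring Z_\beta$ are parallel. A pseudohermitian transformation of $H_n$ is a diffeomorphism preserving $\Theta$ and $J$; a Heisenberg rigid motion is such a transformation, and it has the form $L_p\circ\Phi_U$ with $L_p$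 a left translation and $\Phi_U(z,t)=(Uz,t)$, $U\in U(n)$. A pseudohermitian submanifold of $H_n$ of CR dimension $m\ge 1$ is an injectively immersed smooth manifold $M\subset H_n$ of dimension $2m+1$ such that $\hat\theta=\Theta|_M$ vanishes at no point and $\hat\xi=TM\cap\xi=\ker\hat\theta$ is $J$-invariant; it is equipped with $\hat\theta$ and $\hat J=J|_{\hat\xi}$. Let $\hat\xi^\perp$ be the orthogonal complement of $\hat\xi$ in $\xi|_M$. The fundamental vector field $\nu$ is the section of $\hat\xi^\perp$ such that $T+\nu$ is tangent to $M$, and $M$ is called vertical if $\nu\equiv 0$. The second fundamental form $II$ is given, for $X,Y\in\hat\xi_{1,0}$ and local sections $N$ of $\hat\xi^\perp_{1,0}$, by $II^N(X,Y)=-\langle X,\nabla_{\overline Y}N\rangle$, and $II=0$ means that all these components vanish. **Theorem.** Let $n\ge 2$ and let $M$ be a vertical, simply connected pseudohermitian submanifold of $H_n$ of CR dimension $m=n-1$ with $II=0$. Then, after a Heisenberg rigid motion, $M$ is an open subset of the Heisenberg subgroup $H_{n-1}=\{z_n=0\}$: the inclusion of $M$ in $H_n$ is a topological embedding, and there is a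 Heisenberg rigid motion $\Phi$ of $H_n$ such that $\Phi(M)$ is an open subset of $\{z_n=0\}$. -/

import Mathlib

open scoped Manifold ContDiff Topology

/-- The Heisenberg group `H_n = ℂⁿ × ℝ` with coordinates `(z, t)`, `z = x + i y`, and its usual
smooth structure. All tangent spaces are identified with `ℂⁿ × ℝ`: the pair `(w, s)` stands for
`∑ (Re w_β ∂/∂x_β + Im w_β ∂/∂y_β) + s ∂/∂t`. -/
abbrev Heisenberg (n : ℕ) : Type := (Fin n → ℂ) × ℝ

namespace Heisenberg

variable {n : ℕ}

/-- The group law `(x,y,t) ∘ (x',y',t') = (x + x', y + y', t + t' + y x' - x y')`, which is the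
left translation `L_p` applied to `q`. -/
noncomputable def leftTranslation (p q : Heisenberg n) : Heisenberg n :=
  (p.1 + q.1,
    p.2 + q.2 + ∑ β, ((p.1 β).im * (q.1 β).re - (p.1 β).re * (q.1 β).im))

/-- The rotation `(z, t) ↦ (U z, t)` about the `t`-axis. For `U = A + i B` unitary this is the
real matrix `[[A, -B], [B, A]]` in `SO(2n)` acting on `(x, y)`. -/
noncomputable def rotation (U : Matrix.unitaryGroup (Fin n) ℂ) (q : Heisenberg n) :
    Heisenberg n :=
  ((U : Matrix (Fin n) (Fin n) ℂ).mulVec q.1, q.2)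

/-- The contact form `Θ = dt + ∑ (x_β dy_β - y_β dx_β)` at `q`, evaluated on the vector `v`. -/
noncomputable def contactForm (q v : Heisenberg n) : ℝ :=
  v.2 + ∑ β, ((q.1 β).re * (v.1 β).im - (q.1 β).im * (v.1 β).re)

/-- The horizontal vector at `q` (an element of `ξ = ker Θ`) whose coefficients in the
left-invariant frame `e_β = ∂/∂x_β + y_β ∂/∂t`, `e_{n+β} = ∂/∂y_β - x_β ∂/∂t` are the real and
imaginary parts of `w`, that is `∑ (Re w_β e_β + Im w_β e_{n+β})`. -/
noncomputable def horizontalLift (q : Heisenberg n) (w : Fin n → ℂ) : Heisenberg n :=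
  (w, ∑ β, ((q.1 β).im * (w β).re - (q.1 β).re * (w β).im))

/-- The CR structure `J e_β = e_{n+β}`, `J e_{n+β} = -e_β`, on horizontal vectors at `q`. -/
noncomputable def complexStructure (q v : Heisenberg n) : Heisenberg n :=
  horizontalLift q (Complex.I • v.1)

/-- The Reeb field `T = ∂/∂t`. -/
def reeb : Heisenberg n := (0, 1)

/-- The Levi (Hermitian) metric on horizontal vectors of type `(1,0)`. The vector
`∑ c_β Z_β`, `Z_β = (e_β - i e_{n+β}) / 2`, is represented by its coefficients `c`,
and the `Z_β` are orthonormal. -/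
noncomputable def levi (c d : Fin n → ℂ) : ℂ := ∑ β, c β * (starRingEnd ℂ) (d β)

/-- Pseudohermitian transformations of `H_n` (the elements of `PSH(n)`): the diffeomorphisms that
preserve `Θ` and `J`. -/
structure IsPseudohermitianTransformation (Φ : Heisenberg n ≃ Heisenberg n) : Prop where
  smooth : ContDiff ℝ ∞ Φ
  smooth_symm : ContDiff ℝ ∞ Φ.symm
  contactForm_eq : ∀ q v : Heisenberg n, contactForm (Φ q) (fderiv ℝ Φ q v) = contactForm q v
  complexStructure_eq : ∀ q v : Heisenberg n, contactForm q v = 0 →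
    fderiv ℝ Φ q (complexStructure q v) = complexStructure (Φ q) (fderiv ℝ Φ q v)

/-- Heisenberg rigid motions: pseudohermitian transformations of `H_n`, written as a rotation about
the `t`-axis followed by a left translation. -/
def IsRigidMotion (Φ : Heisenberg n ≃ Heisenberg n) : Prop :=
  IsPseudohermitianTransformation Φ ∧
    ∃ (p : Heisenberg n) (U : Matrix.unitaryGroup (Fin n) ℂ),
      ∀ q, Φ q = leftTranslation p (rotation U q)

/-- The Heisenberg subgroup `H_m = {z_{m+1} = 0}` of `H_{m+1}`. -/
def subgroup (m : ℕ) : Set (Heisenberg (m + 1)) := {q | q.1 (Fin.last m) = 0}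

end Heisenberg

section Submanifold

open Heisenberg

variable (m : ℕ) {n : ℕ} {M : Type*} [TopologicalSpace M]
  [ChartedSpace (EuclideanSpace ℝ (Fin (2 * m + 1))) M]

/-- The differential of `f : M → H_n` at `p`, for `M` of dimension `2m + 1`. -/
noncomputable def tangentMapAt (f : M → Heisenberg n) (p : M) :
    TangentSpace (𝓡 (2 * m + 1)) p →L[ℝ] Heisenberg n :=
  mfderiv (𝓡 (2 * m + 1)) 𝓘(ℝ, Heisenberg n) f p

/-- The induced form `θ̂ = f^* Θ` at `p`. -/
noncomputable def inducedForm (f : M → Heisenberg n) (p : M)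
    (v : TangentSpace (𝓡 (2 * m + 1)) p) : ℝ :=
  contactForm (f p) (tangentMapAt m f p v)

/-- `ξ̂ = TM ∩ ξ` at `p`, as a subspace of `T_p M`. -/
noncomputable def contactPlane (f : M → Heisenberg n) (p : M) :
    Submodule ℝ (TangentSpace (𝓡 (2 * m + 1)) p) where
  carrier := {v | inducedForm m f p v = 0}
  zero_mem' := by simp [inducedForm, contactForm]
  add_mem' := by
    intro a b ha hb
    simp only [Set.mem_ofPred_eq, inducedForm, contactForm] at ha hb ⊢
    rw [map_add]
    have : ∀ u v : Heisenberg n, (u + v).2 + ∑ β, (((f p).1 β).re * ((u + v).1 β).im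
        - ((f p).1 β).im * ((u + v).1 β).re)
        = (u.2 + ∑ β, (((f p).1 β).re * (u.1 β).im - ((f p).1 β).im * (u.1 β).re))
        + (v.2 + ∑ β, (((f p).1 β).re * (v.1 β).im - ((f p).1 β).im * (v.1 β).re)) := by
      intro u v
      have h : ∑ β, (((f p).1 β).re * ((u + v).1 β).im - ((f p).1 β).im * ((u + v).1 β).re)
          = ∑ β, (((f p).1 β).re * (u.1 β).im - ((f p).1 β).im * (u.1 β).re)
          + ∑ β, (((f p).1 β).re * (v.1 β).im - ((f p).1 β).im * (v.1 β).re) := by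
        rw [← Finset.sum_add_distrib]
        refine Finset.sum_congr rfl fun β _ => ?_
        simp only [Prod.fst_add, Pi.add_apply, Complex.add_re, Complex.add_im]
        ring
      rw [h, Prod.snd_add]
      ring
    rw [this, ha, hb, add_zero]
  smul_mem' := by
    intro c a ha
    simp only [Set.mem_ofPred_eq, inducedForm, contactForm] at ha ⊢
    rw [map_smul]
    have : ∀ u : Heisenberg n, (c • u).2 + ∑ β, (((f p).1 β).re * ((c • u).1 β).im
        - ((f p).1 β).im * ((c • u).1 β).re)
        = c * (u.2 + ∑ β, (((f p).1 β).re * (u.1 β).im - ((f p).1 β).im * (u.1 β).re)) := by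
      intro u
      rw [mul_add, Finset.mul_sum]
      congr 1
      refine Finset.sum_congr rfl fun β _ => ?_
      simp only [Prod.smul_fst, Pi.smul_apply, Complex.real_smul, Complex.mul_re, Complex.mul_im,
        Complex.ofReal_re, Complex.ofReal_im]
      ring
    rw [this, ha, mul_zero]

variable (n M) in
/-- A `(2m+1)`-dimensional pseudohermitian submanifold `(M, Ĵ, θ̂)` of `H_n` of CR dimension `m`:
an injectively immersed smooth submanifold such that `θ̂ = Θ|_M` vanishes at no point (so that
`ξ̂ = ker θ̂ = TM ∩ ξ` is a hyperplane field) with `Ĵ = J|_ξ̂` mapping `ξ̂` to itself. As `dΘ` is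
positive on complex lines in `ξ` and `ξ_{1,0}` is involutive, the contact condition and the CR
integrability of the induced structure hold automatically. -/
structure PseudohermitianSubmanifold where
  /-- the inclusion of `M` in `H_n` -/
  toFun : M → Heisenberg n
  smooth : ContMDiff (𝓡 (2 * m + 1)) 𝓘(ℝ, Heisenberg n) ∞ toFun
  injective : Function.Injective toFun
  immersion : ∀ p, Function.Injective (tangentMapAt m toFun p)
  /-- `θ̂` is nowhere zero -/
  inducedForm_ne : ∀ p, ∃ v, inducedForm m toFun p v ≠ 0
  /-- the complex structure `Ĵ` on `ξ̂` -/
  J : ∀ p, contactPlane m toFun p →ₗ[ℝ] contactPlane m toFun p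
  /-- `Ĵ` is the restriction of the complex structure `J` of `H_n` -/
  J_eq : ∀ (p : M) (v : contactPlane m toFun p),
    tangentMapAt m toFun p (J p v) = complexStructure (toFun p) (tangentMapAt m toFun p v)

namespace PseudohermitianSubmanifold

variable {m} (S : PseudohermitianSubmanifold m n M)

/-- For `v ∈ ξ̂_p`, the coefficients of the `(1,0)`-vector `V = (v - i Ĵ v) / 2` in the frame
`Z_β`. If `v = ∑ (a_β e_β + b_β e_{n+β})`, they are `a_β + i b_β`. Every element of `ξ̂_{1,0}` at
`p` is `V` for exactly one `v`. -/
noncomputable def holPart (p : M) (v : contactPlane m S.toFun p) : Fin n → ℂ :=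
  (tangentMapAt m S.toFun p v).1

/-- The vector `∑ c_β Z_β` belongs to the orthogonal complement `ξ̂^⊥_{1,0}` of `ξ̂_{1,0}` at `p`;
equivalently its (doubled) real part `horizontalLift (S.toFun p) c` belongs to `ξ̂^⊥`. -/
def IsNormalAt (p : M) (c : Fin n → ℂ) : Prop :=
  ∀ v : contactPlane m S.toFun p, levi (S.holPart p v) c = 0

/-- `ν = horizontalLift (S.toFun p) c` is the fundamental vector at `p`: `ν` is horizontal, it is
orthogonal to `ξ̂`, and `T + ν` is tangent to `M`. -/
def IsFundamentalVectorAt (p : M) (c : Fin n → ℂ) : Prop :=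
  S.IsNormalAt p c ∧ ∃ v, tangentMapAt m S.toFun p v = reeb + horizontalLift (S.toFun p) c

/-- `M` is vertical: its fundamental vector field `ν` vanishes identically. -/
def IsVertical : Prop := ∀ p, S.IsFundamentalVectorAt p 0

/-- `N = ∑ N_β Z_β`, with coefficients `N_β : M → ℂ`, is a smooth section of the normal bundle
`ξ̂^⊥_{1,0}` over `U`. -/
def IsNormalFieldOn (U : Set M) (N : M → Fin n → ℂ) : Prop :=
  ContMDiffOn (𝓡 (2 * m + 1)) 𝓘(ℝ, Fin n → ℂ) ∞ N U ∧ ∀ q ∈ U, S.IsNormalAt q (N q)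

/-- `∇_v N` for `v ∈ T_p M` and a `(1,0)`-field `N = ∑ N_β Z_β` along `M`. Here `∇` is the
pseudohermitian (Tanaka--Webster) connection of `H_n`, the flat connection for which the
left-invariant fields `Z_β` are parallel, so that `∇_v N = ∑ (v N_β) Z_β`. -/
noncomputable def covDeriv (N : M → Fin n → ℂ) (p : M) (v : TangentSpace (𝓡 (2 * m + 1)) p) :
    Fin n → ℂ :=
  mfderiv (𝓡 (2 * m + 1)) 𝓘(ℝ, Fin n → ℂ) N p v

/-- `∇_{\bar Y} N` at `p` for `Y = (y - i Ĵ y) / 2 ∈ ξ̂_{1,0}`, where `y ∈ ξ̂_p`. -/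
noncomputable def covDerivBar (N : M → Fin n → ℂ) (p : M) (y : contactPlane m S.toFun p) :
    Fin n → ℂ :=
  (1 / 2 : ℂ) • (covDeriv (m := m) N p y.1 + Complex.I • covDeriv (m := m) N p (S.J p y).1)

/-- The component `II^N(X, Y) = - ⟨X, ∇_{\bar Y} N⟩` of the second fundamental form in the
direction of the normal field `N`, at `p`, for `X = (x - i Ĵ x) / 2` and `Y = (y - i Ĵ y) / 2` in
`ξ̂_{1,0}`. -/
noncomputable def secondFundamentalForm (N : M → Fin n → ℂ) (p : M)
    (x y : contactPlane m S.toFun p) : ℂ :=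
  - levi (S.holPart p x) (S.covDerivBar N p y)

/-- `II = 0`: all components of the second fundamental form vanish, with respect to all local
sections of the normal bundle. -/
def SecondFundamentalFormVanishes : Prop :=
  ∀ (U : Set M) (N : M → Fin n → ℂ), IsOpen U → S.IsNormalFieldOn U N →
    ∀ p ∈ U, ∀ x y : contactPlane m S.toFun p, S.secondFundamentalForm N p x y = 0

end PseudohermitianSubmanifold

end Submanifold

/-! Write z for the ℂⁿ-component of the inclusion. Verticality puts the Reeb direction in every
tangent space; it spans the kernel of dz, so the image of dz is a complex hyperplane W_p of ℂ^(m+1).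
The point is that W_p does not depend on p. For a local normal field N put b(v, w) = ⟨dz v, ∇_w N⟩.
Differentiating ⟨dz v, N⟩ = 0 gives b(v, w) = -⟨D²z(w, v), N⟩, which is symmetric
(`IsNormalFieldOn.levi_dz_mfderiv_comm`). On contact vectors b is complex linear in v, hence by
symmetry also in w, so II, although it only sees ∇_{\bar Y} N, determines all of b. Thus II = 0
makes every derivative of N orthogonal to W_p (`levi_dz_covDeriv_eq_zero`). In codimension one, N
can be normalised by ⟨r, N⟩ = 1 with r constant and transverse to W_p. Its derivatives are then
orthogonal to r as well, so they vanish: N, and with it W_p, is locally constant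
(`isLocallyConstant_horizontalImage`), and constant by connectedness. A unitary matrix turns W_p
into {z_n = 0}; the last coordinate then has zero derivative and is removed by a translation. What
remains is an injective immersion into a space of the same dimension, which is an open embedding. -/

/-! ### Differential calculus of vector-valued maps in charts. -/

section ChartCalculus

open Filter

variable {E : Type*} [NormedAddCommGroup E] [NormedSpace ℝ E] {V : Type*} [NormedAddCommGroup V]
  [NormedSpace ℝ V] {M : Type*} [TopologicalSpace M] [ChartedSpace E M]

/-- The derivative of a chart, as an equivalence of the tangent space with the model space. -/
noncomputable def chartDifferential [IsManifold 𝓘(ℝ, E) 1 M] {p q : M}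
    (hq : q ∈ (chartAt E p).source) : TangentSpace 𝓘(ℝ, E) q ≃L[ℝ] E :=
  (mdifferentiable_chart (I := 𝓘(ℝ, E)) p).mfderiv hq

/-- The derivative of a vector-valued map on a manifold, read in a chart. -/
theorem mfderiv_eq_fderiv_comp_chartAt [IsManifold 𝓘(ℝ, E) 1 M] {X : M → V} {p q : M}
    (hX : MDifferentiableAt 𝓘(ℝ, E) 𝓘(ℝ, V) X q) (hq : q ∈ (chartAt E p).source)
    (v : TangentSpace 𝓘(ℝ, E) q) :
    mfderiv 𝓘(ℝ, E) 𝓘(ℝ, V) X q v =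
      fderiv ℝ (X ∘ (chartAt E p).symm) (chartAt E p q)
        (chartDifferential hq v) := by
  have hφ := mdifferentiable_chart (I := 𝓘(ℝ, E)) p
  have h1 := hφ.symm_comp_deriv hq
  have hs : (chartAt E p).symm (chartAt E p q) = q := (chartAt E p).left_inv hq
  have h2 : MDifferentiableAt 𝓘(ℝ, E) 𝓘(ℝ, V) X ((chartAt E p).symm (chartAt E p q)) := by
    rwa [hs]
  have h3 := mfderiv_comp (chartAt E p q) h2
    (hφ.mdifferentiableAt_symm ((chartAt E p).map_source hq))
  rw [← mfderiv_eq_fderiv, h3]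
  change _ = mfderiv 𝓘(ℝ, E) 𝓘(ℝ, V) X ((chartAt E p).symm (chartAt E p q))
    (mfderiv 𝓘(ℝ, E) 𝓘(ℝ, E) (chartAt E p).symm (chartAt E p q)
      (mfderiv 𝓘(ℝ, E) 𝓘(ℝ, E) (chartAt E p) q v))
  have h4 := DFunLike.congr_fun h1 v
  simp only [ContinuousLinearMap.comp_apply] at h4
  erw [h4]
  congr 1
  rw [hs]

theorem ContMDiffOn.contDiffAt_comp_chartAt_symm [IsManifold 𝓘(ℝ, E) ∞ M] {X : M → V} {U : Set M}
    (hU : IsOpen U) (hX : ContMDiffOn 𝓘(ℝ, E) 𝓘(ℝ, V) ∞ X U) {p q : M}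
    (hq : q ∈ (chartAt E p).source) (hqU : q ∈ U) :
    ContDiffAt ℝ ∞ (X ∘ (chartAt E p).symm) (chartAt E p q) := by
  rw [← contMDiffAt_iff_contDiffAt]
  have hs : (chartAt E p).symm (chartAt E p q) = q := (chartAt E p).left_inv hq
  refine ContMDiffAt.comp (I' := 𝓘(ℝ, E)) (chartAt E p q) ?_ ?_
  · rw [hs]
    exact hX.contMDiffAt (hU.mem_nhds hqU)
  · exact (contMDiffOn_chart_symm (x := p)).contMDiffAt
      ((chartAt E p).open_target.mem_nhds ((chartAt E p).map_source hq))

/-- A map with vanishing derivative near a point is constant near that point. -/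
theorem eventually_eq_of_mfderiv_eq_zero [IsManifold 𝓘(ℝ, E) 1 M] {X : M → V} {p : M}
    (hX : ∀ᶠ q in 𝓝 p, MDifferentiableAt 𝓘(ℝ, E) 𝓘(ℝ, V) X q ∧
      mfderiv 𝓘(ℝ, E) 𝓘(ℝ, V) X q = 0) :
    ∀ᶠ q in 𝓝 p, X q = X p := by
  set φ := chartAt E p
  have hp : p ∈ φ.source := mem_chart_source E p
  have hφ := mdifferentiable_chart (I := 𝓘(ℝ, E)) p
  have h1 : ∀ᶠ u in 𝓝 (φ p), u ∈ φ.target ∧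
      (MDifferentiableAt 𝓘(ℝ, E) 𝓘(ℝ, V) X (φ.symm u) ∧
        mfderiv 𝓘(ℝ, E) 𝓘(ℝ, V) X (φ.symm u) = 0) := by
    refine (φ.open_target.eventually_mem (φ.map_source hp)).and ?_
    exact (φ.tendsto_symm hp).eventually hX
  obtain ⟨r, hr, hball⟩ := Metric.eventually_nhds_iff_ball.1 h1
  have hd : ∀ u ∈ Metric.ball (φ p) r, HasFDerivAt (X ∘ φ.symm) (0 : E →L[ℝ] V) u := by
    intro u hu
    obtain ⟨hut, hm, h0⟩ := hball u hu
    have := (hm.hasMFDerivAt).comp u (hφ.mdifferentiableAt_symm hut).hasMFDerivAt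
    rw [h0] at this
    exact this.hasFDerivAt.congr_fderiv (ContinuousLinearMap.zero_comp _)
  have hc : ∀ᶠ u in 𝓝 (φ p), X (φ.symm u) = X (φ.symm (φ p)) := by
    filter_upwards [Metric.ball_mem_nhds (φ p) hr] with u hu
    exact Metric.isOpen_ball.is_const_of_fderiv_eq_zero (𝕜 := ℝ)
      (convex_ball (φ p) r).isPreconnected
      (fun u hu => (hd u hu).differentiableAt.differentiableWithinAt)
      (fun u hu => (hd u hu).fderiv) hu (Metric.mem_ball_self hr)
  filter_upwards [(φ.continuousAt hp).eventually hc, φ.open_source.mem_nhds hp] with q hq hqs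
  rwa [φ.left_inv hqs, φ.left_inv hp] at hq

/-- A smooth map whose derivatives are onto is open. -/
theorem ContMDiff.isOpenMap_of_mfderiv_surjective [IsManifold 𝓘(ℝ, E) ∞ M] [CompleteSpace E]
    [CompleteSpace V] {X : M → V} (hX : ContMDiff 𝓘(ℝ, E) 𝓘(ℝ, V) ∞ X)
    (hs : ∀ p, Function.Surjective (mfderiv 𝓘(ℝ, E) 𝓘(ℝ, V) X p)) : IsOpenMap X := by
  have : IsManifold 𝓘(ℝ, E) 1 M := IsManifold.of_le (n := ∞) (by simp)
  refine IsOpenMap.of_nhds_le fun p => ?_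
  set φ := chartAt E p
  have hp : p ∈ φ.source := mem_chart_source E p
  have hc : ContDiffAt ℝ ∞ (X ∘ φ.symm) (φ p) :=
    (hX.contMDiffOn (s := Set.univ)).contDiffAt_comp_chartAt_symm isOpen_univ hp trivial
  have hst := hc.hasStrictFDerivAt (by simp)
  -- A surjective strict derivative makes the chart expression send the neighbourhood filter onto
  -- the neighbourhood filter of the value.
  have hmap := hst.map_nhds_eq_of_surj <| by
    rw [LinearMap.range_eq_top]
    intro w
    obtain ⟨v, hv⟩ := hs p w
    rw [mfderiv_eq_fderiv_comp_chartAt ((hX p).mdifferentiableAt (by simp)) hp] at hv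
    exact ⟨_, hv⟩
  rw [Function.comp_apply, φ.left_inv hp, ← Filter.map_map] at hmap
  rw [← hmap]
  exact Filter.map_mono (φ.tendsto_symm hp)

end ChartCalculus

/-! ### Rigid motions and rotation of complex subspaces. -/

namespace Heisenberg

open Matrix

variable {n : ℕ}

/-- The group law, the contact form and horizontal lifts all involve this one expression; in
Hermitian form its unitary invariance becomes visible. -/
theorem sum_im_mul_re_sub (a b : Fin n → ℂ) :
    ∑ β, ((a β).im * (b β).re - (a β).re * (b β).im) = -(star a ⬝ᵥ b).im := by
  simp only [dotProduct, Complex.im_sum, ← Finset.sum_neg_distrib, Pi.star_apply]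
  refine Finset.sum_congr rfl fun β _ => ?_
  simp [Complex.mul_im]
  ring

theorem contactForm_eq_add_im (q v : Heisenberg n) :
    contactForm q v = v.2 + (star q.1 ⬝ᵥ v.1).im := by
  have h := sum_im_mul_re_sub q.1 v.1
  rw [contactForm, ← neg_eq_iff_eq_neg.2 h, ← Finset.sum_neg_distrib]
  simp

theorem horizontalLift_eq (q : Heisenberg n) (w : Fin n → ℂ) :
    horizontalLift q w = (w, -(star q.1 ⬝ᵥ w).im) := by
  rw [horizontalLift, sum_im_mul_re_sub]

theorem leftTranslation_eq (p q : Heisenberg n) :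
    leftTranslation p q = (p.1 + q.1, p.2 + q.2 - (star p.1 ⬝ᵥ q.1).im) := by
  rw [leftTranslation, sum_im_mul_re_sub, sub_eq_add_neg]

theorem star_mulVec_dotProduct_mulVec (U : Matrix.unitaryGroup (Fin n) ℂ) (a b : Fin n → ℂ) :
    star ((U : Matrix (Fin n) (Fin n) ℂ) *ᵥ a) ⬝ᵥ ((U : Matrix (Fin n) (Fin n) ℂ) *ᵥ b) =
      star a ⬝ᵥ b := by
  rw [star_mulVec, dotProduct_mulVec, vecMul_vecMul, ← star_eq_conjTranspose,
    Unitary.coe_star_mul_self, vecMul_one]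

/-- The central term of the group law vanishes on parallel real directions, which is why translation
by -p inverts translation by p. -/
theorem star_dotProduct_self_im (a : Fin n → ℂ) : (star a ⬝ᵥ a).im = 0 := by
  rw [← neg_eq_zero, ← sum_im_mul_re_sub]
  exact Finset.sum_eq_zero fun β _ => by ring

/-- The linear part of `L_p ∘ Φ_U`, as a continuous linear map. -/
noncomputable def rigidMotionLinear (a : Fin n → ℂ) (U : Matrix.unitaryGroup (Fin n) ℂ) :
    Heisenberg n →L[ℝ] Heisenberg n :=
  LinearMap.toContinuousLinearMap
    { toFun := fun q => ((U : Matrix (Fin n) (Fin n) ℂ) *ᵥ q.1,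
        q.2 - (star a ⬝ᵥ ((U : Matrix (Fin n) (Fin n) ℂ) *ᵥ q.1)).im)
      map_add' := fun q r => by
        ext
        · simp [mulVec_add]
        · simp [mulVec_add, dotProduct_add]
          ring
      map_smul' := fun c q => by
        ext
        · simp [mulVec_smul]
        · simp [mulVec_smul, dotProduct_smul]
          ring }

theorem rigidMotionLinear_apply (a : Fin n → ℂ) (U : Matrix.unitaryGroup (Fin n) ℂ)
    (q : Heisenberg n) :
    rigidMotionLinear a U q = ((U : Matrix (Fin n) (Fin n) ℂ) *ᵥ q.1,
      q.2 - (star a ⬝ᵥ ((U : Matrix (Fin n) (Fin n) ℂ) *ᵥ q.1)).im) := rfl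

theorem leftTranslation_rotation (p q : Heisenberg n) (U : Matrix.unitaryGroup (Fin n) ℂ) :
    leftTranslation p (rotation U q) = p + rigidMotionLinear p.1 U q := by
  rw [leftTranslation_eq, rigidMotionLinear_apply, rotation]
  ext <;> simp
  ring

/-- The map `L_p ∘ Φ_U` as a bijection. -/
noncomputable def rigidMotion (p : Heisenberg n) (U : Matrix.unitaryGroup (Fin n) ℂ) :
    Heisenberg n ≃ Heisenberg n where
  toFun q := leftTranslation p (rotation U q)
  invFun q := rotation (star U) (leftTranslation (-p) q)
  left_inv q := by
    have := star_dotProduct_self_im p.1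
    ext : 1
    · simp [leftTranslation_eq, rotation]
    · simp [leftTranslation_eq, rotation, dotProduct_add, this]
      ring
  right_inv q := by
    have := star_dotProduct_self_im p.1
    ext : 1
    · simp [leftTranslation_eq, rotation]
    · simp [leftTranslation_eq, rotation, dotProduct_add, this]
      ring

theorem rigidMotion_apply (p : Heisenberg n) (U : Matrix.unitaryGroup (Fin n) ℂ)
    (q : Heisenberg n) : rigidMotion p U q = p + rigidMotionLinear p.1 U q :=
  leftTranslation_rotation p q U

theorem hasFDerivAt_rigidMotion (p : Heisenberg n) (U : Matrix.unitaryGroup (Fin n) ℂ)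
    (q : Heisenberg n) : HasFDerivAt (rigidMotion p U) (rigidMotionLinear p.1 U) q := by
  have h : ⇑(rigidMotion p U) = fun q => p + rigidMotionLinear p.1 U q :=
    funext (rigidMotion_apply p U)
  rw [h]
  exact (rigidMotionLinear p.1 U).hasFDerivAt.const_add p

theorem contDiff_rigidMotion (p : Heisenberg n) (U : Matrix.unitaryGroup (Fin n) ℂ) :
    ContDiff ℝ ∞ (rigidMotion p U) := by
  have h : ⇑(rigidMotion p U) = fun q => p + rigidMotionLinear p.1 U q :=
    funext (rigidMotion_apply p U)
  rw [h]
  exact contDiff_const.add (rigidMotionLinear p.1 U).contDiff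

theorem contDiff_rigidMotion_symm (p : Heisenberg n) (U : Matrix.unitaryGroup (Fin n) ℂ) :
    ContDiff ℝ ∞ (rigidMotion p U).symm := by
  have h : ⇑(rigidMotion p U).symm =
      fun q => rigidMotionLinear 0 (star U) (-p + rigidMotionLinear (-p).1 1 q) := by
    funext q
    change rotation (star U) (leftTranslation (-p) q) = _
    rw [← leftTranslation_rotation, rigidMotionLinear_apply]
    simp [rotation]
  rw [h]
  exact (rigidMotionLinear _ _).contDiff.comp
    (contDiff_const.add (rigidMotionLinear _ _).contDiff)

theorem isRigidMotion_rigidMotion (p : Heisenberg n) (U : Matrix.unitaryGroup (Fin n) ℂ) :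
    IsRigidMotion (rigidMotion p U) := by
  refine ⟨⟨contDiff_rigidMotion p U, contDiff_rigidMotion_symm p U, fun q v => ?_,
    fun q v _ => ?_⟩, p, U, fun q => rfl⟩
  · rw [(hasFDerivAt_rigidMotion p U q).fderiv, rigidMotion_apply, contactForm_eq_add_im,
      contactForm_eq_add_im, rigidMotionLinear_apply, rigidMotionLinear_apply]
    simp [add_dotProduct, star_mulVec_dotProduct_mulVec]
    ring
  · rw [(hasFDerivAt_rigidMotion p U q).fderiv, rigidMotion_apply, complexStructure,
      complexStructure, horizontalLift_eq, horizontalLift_eq, rigidMotionLinear_apply,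
      rigidMotionLinear_apply, rigidMotionLinear_apply]
    ext : 1
    · simp [mulVec_smul]
    · simp only [Prod.fst_add, star_add, add_dotProduct, mulVec_smul, dotProduct_smul,
        star_mulVec_dotProduct_mulVec, smul_add, Complex.add_im]
      abel

/-- A complex subspace of positive codimension is rotated into `{z_n = 0}` by a unitary matrix. -/
theorem exists_unitary_mulVec_last_eq_zero {m : ℕ} {W : Submodule ℂ (Fin (m + 1) → ℂ)}
    (hW : W ≠ ⊤) : ∃ U : Matrix.unitaryGroup (Fin (m + 1)) ℂ,
      ∀ w ∈ W, ((U : Matrix (Fin (m + 1)) (Fin (m + 1)) ℂ) *ᵥ w) (Fin.last m) = 0 := by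
  let e := WithLp.linearEquiv 2 ℂ (Fin (m + 1) → ℂ)
  let K : Submodule ℂ (EuclideanSpace ℂ (Fin (m + 1))) := W.comap (e : _ →ₗ[ℂ] _)
  have hK : K ≠ ⊤ := by
    intro h
    refine hW (eq_top_iff.2 fun w _ => ?_)
    have : e.symm w ∈ K := h ▸ Submodule.mem_top
    simpa [K] using this
  obtain ⟨c, hcK, hc0⟩ := Submodule.exists_mem_ne_zero_of_ne_bot
    (mt Submodule.orthogonal_eq_bot_iff.1 hK)
  let c' : EuclideanSpace ℂ (Fin (m + 1)) := ((‖c‖ : ℂ)⁻¹) • c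
  have hc' : ‖c'‖ = 1 := by simp [c', norm_smul, hc0]
  have hc'K : c' ∈ Kᗮ := Submodule.smul_mem _ _ hcK
  obtain ⟨b, hb⟩ := Orthonormal.exists_orthonormalBasis_extension_of_card_eq (𝕜 := ℂ)
    (E := EuclideanSpace ℂ (Fin (m + 1))) (ι := Fin (m + 1)) (by simp)
    (v := fun _ => c') (s := {Fin.last m}) (by
      rw [orthonormal_iff_ite]
      rintro ⟨i, rfl⟩ ⟨j, rfl⟩
      simp [inner_self_eq_norm_sq_to_K, hc'])
  have hbl : b (Fin.last m) = c' := hb _ rfl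
  -- The rows are the conjugated basis vectors, so the last entry of U w is the inner product of w
  -- with the unit vector `c'` orthogonal to W.
  let U : Matrix (Fin (m + 1)) (Fin (m + 1)) ℂ := Matrix.of fun i j => star (b i j)
  have hU : U * star U = 1 := by
    ext i k
    have h := orthonormal_iff_ite.1 b.orthonormal i k
    rw [EuclideanSpace.inner_eq_star_dotProduct] at h
    rw [Matrix.mul_apply, Matrix.one_apply, ← h]
    simp [U, dotProduct, Matrix.star_apply, mul_comm]
  refine ⟨⟨U, Matrix.mem_unitaryGroup_iff.2 hU⟩, fun w hw => ?_⟩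
  have h := (Submodule.mem_orthogonal' K c').1 hc'K (e.symm w) (by simpa [K] using hw)
  rw [EuclideanSpace.inner_eq_star_dotProduct, ← hbl] at h
  rw [← h]
  simp [Matrix.mulVec, U, dotProduct, e, mul_comm]

end Heisenberg

/-! ### Bilinearity of the Levi metric and the contact form. -/

namespace Heisenberg

/-- The Levi metric as a real bilinear map. -/
noncomputable def leviBilin (n : ℕ) : (Fin n → ℂ) →L[ℝ] (Fin n → ℂ) →L[ℝ] ℂ :=
  LinearMap.toContinuousBilinearMap <| LinearMap.mk₂ ℝ levi
    (fun a b c => by simp [levi, add_mul, Finset.sum_add_distrib])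
    (fun r a b => by simp [levi, Finset.mul_sum, mul_assoc])
    (fun a b c => by simp [levi, mul_add, Finset.sum_add_distrib])
    (fun r a b => by simp [levi, Finset.mul_sum, mul_left_comm])

theorem leviBilin_apply {n : ℕ} (a b : Fin n → ℂ) : leviBilin n a b = levi a b := rfl

theorem levi_smul_left {n : ℕ} (c : ℂ) (a b : Fin n → ℂ) : levi (c • a) b = c * levi a b := by
  simp [levi, Finset.mul_sum, mul_assoc]

theorem levi_smul_right {n : ℕ} (c : ℂ) (a b : Fin n → ℂ) :
    levi a (c • b) = (starRingEnd ℂ) c * levi a b := by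
  simp [levi, Finset.mul_sum, mul_left_comm]

theorem levi_add_left {n : ℕ} (a b c : Fin n → ℂ) : levi (a + b) c = levi a c + levi b c := by
  simp [levi, add_mul, Finset.sum_add_distrib]

theorem levi_add_right {n : ℕ} (a b c : Fin n → ℂ) : levi a (b + c) = levi a b + levi a c := by
  simp [levi, mul_add, Finset.sum_add_distrib]

theorem contactForm_add {n : ℕ} (q v w : Heisenberg n) :
    contactForm q (v + w) = contactForm q v + contactForm q w := by
  simp [contactForm_eq_add_im, dotProduct_add]
  ring

theorem contactForm_smul {n : ℕ} (q v : Heisenberg n) (c : ℝ) :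
    contactForm q (c • v) = c * contactForm q v := by
  simp [contactForm_eq_add_im, dotProduct_smul]
  ring

end Heisenberg

/-! ### The differential of the z-component and the second fundamental form. -/

namespace PseudohermitianSubmanifold

open Heisenberg

variable {m n : ℕ} {M : Type*} [TopologicalSpace M]
  [ChartedSpace (EuclideanSpace ℝ (Fin (2 * m + 1))) M] (S : PseudohermitianSubmanifold m n M)

/-- The `ℂⁿ`-component of the inclusion. -/
def zMap (p : M) : Fin n → ℂ := (S.toFun p).1

/-- The differential of `zMap`. -/
noncomputable def dz (p : M) : TangentSpace (𝓡 (2 * m + 1)) p →L[ℝ] (Fin n → ℂ) :=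
  (ContinuousLinearMap.fst ℝ (Fin n → ℂ) ℝ).comp (tangentMapAt m S.toFun p)

theorem dz_apply (p : M) (v : TangentSpace (𝓡 (2 * m + 1)) p) :
    S.dz p v = (tangentMapAt m S.toFun p v).1 := rfl

theorem contMDiff_zMap : ContMDiff (𝓡 (2 * m + 1)) 𝓘(ℝ, Fin n → ℂ) ∞ S.zMap :=
  (ContinuousLinearMap.fst ℝ (Fin n → ℂ) ℝ).contMDiff.comp S.smooth

theorem mfderiv_zMap (p : M) :
    mfderiv (𝓡 (2 * m + 1)) 𝓘(ℝ, Fin n → ℂ) S.zMap p = S.dz p := by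
  have h := ((ContinuousLinearMap.fst ℝ (Fin n → ℂ) ℝ).hasMFDerivAt (x := S.toFun p)).comp p
    ((S.smooth p).mdifferentiableAt (by simp)).hasMFDerivAt
  exact h.mfderiv

/-- A fixed coordinate vector X thus yields a smoothly varying family of values of dz, along which
identities can be differentiated. -/
theorem fderiv_zMap_comp_chartAt_symm [IsManifold (𝓡 (2 * m + 1)) ∞ M] {p q : M}
    (hq : q ∈ (chartAt (EuclideanSpace ℝ (Fin (2 * m + 1))) p).source)
    (X : EuclideanSpace ℝ (Fin (2 * m + 1))) :
    haveI : IsManifold (𝓡 (2 * m + 1)) 1 M := IsManifold.of_le (n := ∞) (by simp)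
    fderiv ℝ (S.zMap ∘ (chartAt (EuclideanSpace ℝ (Fin (2 * m + 1))) p).symm)
      (chartAt (EuclideanSpace ℝ (Fin (2 * m + 1))) p q) X =
        S.dz q ((chartDifferential hq).symm X) := by
  have : IsManifold (𝓡 (2 * m + 1)) 1 M := IsManifold.of_le (n := ∞) (by simp)
  have h := mfderiv_eq_fderiv_comp_chartAt
    ((S.contMDiff_zMap q).mdifferentiableAt (by simp)) hq ((chartDifferential hq).symm X)
  rw [ContinuousLinearEquiv.apply_symm_apply, mfderiv_zMap] at h
  exact h.symm

variable {S}

theorem IsVertical.exists_reebLift (hS : S.IsVertical) (p : M) :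
    ∃ v : TangentSpace (𝓡 (2 * m + 1)) p, tangentMapAt m S.toFun p v = (0, 1) := by
  obtain ⟨-, v, hv⟩ := hS p
  refine ⟨v, hv.trans ?_⟩
  simp [reeb, horizontalLift_eq]

/-- On a vertical submanifold, every value of `dz` is taken on a contact vector. -/
theorem IsVertical.exists_contact_dz_eq (hS : S.IsVertical) (p : M)
    (v : TangentSpace (𝓡 (2 * m + 1)) p) :
    ∃ (y : contactPlane m S.toFun p) (T : TangentSpace (𝓡 (2 * m + 1)) p) (s : ℝ),
      S.dz p T = 0 ∧ v = y + s • T := by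
  obtain ⟨T, hT⟩ := hS.exists_reebLift p
  -- The Reeb lift has contact form 1 and is killed by dz, so removing its multiple makes v contact
  -- without changing dz v.
  have hy : v + (-inducedForm m S.toFun p v) • T ∈ contactPlane m S.toFun p := by
    change contactForm _ _ = 0
    rw [map_add, map_smul, contactForm_add, contactForm_smul, hT, inducedForm]
    simp [contactForm_eq_add_im (v := ((0, 1) : Heisenberg n))]
  refine ⟨⟨_, hy⟩, T, inducedForm m S.toFun p v, ?_, ?_⟩
  · rw [dz_apply, hT]
  · simp

theorem dz_J (p : M) (y : contactPlane m S.toFun p) :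
    S.dz p (S.J p y) = Complex.I • S.dz p y := by
  rw [dz_apply, S.J_eq]
  rfl

/-- The image of `dz` at a point of a vertical submanifold, a complex subspace. -/
noncomputable def horizontalImage (hS : S.IsVertical) (p : M) : Submodule ℂ (Fin n → ℂ) where
  carrier := Set.range (S.dz p)
  zero_mem' := ⟨0, map_zero _⟩
  add_mem' := by
    rintro _ _ ⟨v, rfl⟩ ⟨w, rfl⟩
    exact ⟨v + w, map_add _ _ _⟩
  smul_mem' := by
    rintro c _ ⟨v, rfl⟩
    obtain ⟨y, T, s, hT, rfl⟩ := hS.exists_contact_dz_eq p v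
    -- Since dz carries the complex structure to multiplication by i, this vector maps to c times dz
    -- y.
    refine ⟨c.re • (y : TangentSpace (𝓡 (2 * m + 1)) p) + c.im • (S.J p y).1, ?_⟩
    rw [map_add, map_add, map_smul, map_smul, map_smul, dz_J, hT, smul_zero, add_zero]
    conv_rhs => rw [← Complex.re_add_im c]
    rw [add_smul, mul_smul, Complex.coe_smul, Complex.coe_smul]

theorem mem_horizontalImage {hS : S.IsVertical} {p : M} {w : Fin n → ℂ} :
    w ∈ horizontalImage hS p ↔ ∃ v, S.dz p v = w := Iff.rfl

/-- A vector killed by dz has an image along ∂/∂t, so by the immersion property it is a multiple of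
the Reeb lift. The kernel is a line and the real rank is 2m. -/
theorem finrank_horizontalImage (hS : S.IsVertical) (p : M) :
    Module.finrank ℂ (horizontalImage hS p) = m := by
  obtain ⟨T, hT⟩ := hS.exists_reebLift p
  have hT0 : T ≠ 0 := by
    rintro rfl
    rw [map_zero] at hT
    simpa using congrArg Prod.snd hT
  have hfin : Module.finrank ℝ (TangentSpace (𝓡 (2 * m + 1)) p) = 2 * m + 1 :=
    finrank_euclideanSpace_fin
  have : FiniteDimensional ℝ (TangentSpace (𝓡 (2 * m + 1)) p) :=
    inferInstanceAs (FiniteDimensional ℝ (EuclideanSpace ℝ (Fin (2 * m + 1))))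
  let L : TangentSpace (𝓡 (2 * m + 1)) p →ₗ[ℝ] (Fin n → ℂ) := (S.dz p).toLinearMap
  have hker : LinearMap.ker L = Submodule.span ℝ {T} := by
    ext v
    rw [LinearMap.mem_ker, Submodule.mem_span_singleton]
    constructor
    · intro hv
      refine ⟨(tangentMapAt m S.toFun p v).2, ?_⟩
      refine S.immersion p ?_
      refine (map_smul (tangentMapAt m S.toFun p) _ T).trans ?_
      rw [hT]
      have h1 : (tangentMapAt m S.toFun p v).1 = 0 := hv
      ext : 1
      · rw [h1]; simp
      · simp
    · rintro ⟨c, rfl⟩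
      change S.dz p (c • T) = 0
      rw [map_smul, dz_apply, hT, smul_zero]
  have h1 := L.finrank_range_add_finrank_ker
  rw [hker, finrank_span_singleton hT0, hfin] at h1
  have h2 : Module.finrank ℝ (horizontalImage hS p) = Module.finrank ℝ (LinearMap.range L) := rfl
  have h3 := finrank_real_of_complex (horizontalImage hS p)
  omega

/-- On a vertical submanifold, a normal vector is orthogonal to the whole image of `dz`. -/
theorem IsNormalAt.levi_dz_eq_zero (hS : S.IsVertical) {p : M} {c : Fin n → ℂ}
    (hc : S.IsNormalAt p c) (v : TangentSpace (𝓡 (2 * m + 1)) p) : levi (S.dz p v) c = 0 := by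
  obtain ⟨y, T, s, hT, rfl⟩ := hS.exists_contact_dz_eq p v
  rw [map_add, map_smul, hT, smul_zero, add_zero]
  exact hc y

open Filter

/-- The derivative of a normal field pairs symmetrically with `dz`. -/
theorem IsNormalFieldOn.levi_dz_mfderiv_comm [IsManifold (𝓡 (2 * m + 1)) ∞ M]
    (hS : S.IsVertical) {U : Set M} (hU : IsOpen U) {N : M → Fin n → ℂ}
    (hN : S.IsNormalFieldOn U N) {p : M} (hp : p ∈ U) (v w : TangentSpace (𝓡 (2 * m + 1)) p) :
    levi (S.dz p v) (covDeriv (m := m) N p w) = levi (S.dz p w) (covDeriv (m := m) N p v) := by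
  have : IsManifold (𝓡 (2 * m + 1)) 1 M := IsManifold.of_le (n := ∞) (by simp)
  set φ := chartAt (EuclideanSpace ℝ (Fin (2 * m + 1))) p
  have hpφ : p ∈ φ.source := mem_chart_source _ p
  have hz : ContDiffAt ℝ ∞ (S.zMap ∘ φ.symm) (φ p) :=
    S.contMDiff_zMap.contMDiffOn.contDiffAt_comp_chartAt_symm isOpen_univ hpφ trivial
  have hNφ : ContDiffAt ℝ ∞ (N ∘ φ.symm) (φ p) :=
    hN.1.contDiffAt_comp_chartAt_symm hU hpφ hp
  have hsymm : IsSymmSndFDerivAt ℝ (S.zMap ∘ φ.symm) (φ p) :=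
    hz.isSymmSndFDerivAt (by
    rw [minSmoothness_of_isRCLikeNormedField]
    exact WithTop.coe_le_coe.2 (le_top (α := ℕ∞)))
  have hz' : HasFDerivAt (fderiv ℝ (S.zMap ∘ φ.symm))
      (fderiv ℝ (fderiv ℝ (S.zMap ∘ φ.symm)) (φ p)) (φ p) :=
    ((hz.fderiv_right (m := 1) (WithTop.coe_le_coe.2 (le_top (α := ℕ∞)))).differentiableAt (by simp)).hasFDerivAt
  have hN' : HasFDerivAt (N ∘ φ.symm) (fderiv ℝ (N ∘ φ.symm) (φ p)) (φ p) :=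
    (hNφ.differentiableAt (by simp)).hasFDerivAt
  have horth : ∀ᶠ u in 𝓝 (φ p), ∀ X, leviBilin n (fderiv ℝ (S.zMap ∘ φ.symm) u X)
      ((N ∘ φ.symm) u) = 0 := by
    filter_upwards [φ.open_target.mem_nhds (φ.map_source hpφ),
      (φ.tendsto_symm hpφ).eventually (hU.mem_nhds hp)] with u hu huU X
    have hq : φ.symm u ∈ φ.source := φ.map_target hu
    have h1 := S.fderiv_zMap_comp_chartAt_symm hq X
    rw [show chartAt (EuclideanSpace ℝ (Fin (2 * m + 1))) p (φ.symm u) = u from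
      φ.right_inv hu] at h1
    rw [h1]
    exact (hN.2 _ huU).levi_dz_eq_zero hS _
  -- The Leibniz rule applied to ⟨dz X, N⟩ = 0 along Y; the right side is symmetric in X and Y
  -- because second derivatives commute.
  have hpair : ∀ X Y : EuclideanSpace ℝ (Fin (2 * m + 1)),
      levi (fderiv ℝ (S.zMap ∘ φ.symm) (φ p) X) (fderiv ℝ (N ∘ φ.symm) (φ p) Y) =
        -levi (fderiv ℝ (fderiv ℝ (S.zMap ∘ φ.symm)) (φ p) Y X) (N (φ.symm (φ p))) := by
    intro X Y
    have h1 := (leviBilin n).hasFDerivAt_of_bilinear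
      (hz'.clm_apply (hasFDerivAt_const X (φ p))) hN'
    have h2 := h1.unique ((hasFDerivAt_const (0 : ℂ) (φ p)).congr_of_eventuallyEq
      (horth.mono fun u hu => hu X))
    have h3 := DFunLike.congr_fun h2 Y
    simp [leviBilin_apply] at h3
    exact eq_neg_of_add_eq_zero_left h3
  have hzv := fun v => mfderiv_eq_fderiv_comp_chartAt
      ((S.contMDiff_zMap p).mdifferentiableAt (by simp)) hpφ v
  have hNv := fun v => mfderiv_eq_fderiv_comp_chartAt
      ((hN.1.contMDiffAt (hU.mem_nhds hp)).mdifferentiableAt (by simp)) hpφ v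
  rw [mfderiv_zMap] at hzv
  rw [covDeriv, covDeriv]
  erw [hzv, hzv, hNv, hNv, hpair, hpair]
  rw [hsymm.eq]

/-- If `II = 0` on a vertical submanifold, the derivatives of normal fields are normal. -/
theorem SecondFundamentalFormVanishes.levi_dz_covDeriv_eq_zero
    [IsManifold (𝓡 (2 * m + 1)) ∞ M] (hII : S.SecondFundamentalFormVanishes)
    (hS : S.IsVertical) {U : Set M} (hU : IsOpen U) {N : M → Fin n → ℂ}
    (hN : S.IsNormalFieldOn U N) {p : M} (hp : p ∈ U) (v w : TangentSpace (𝓡 (2 * m + 1)) p) :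
    levi (S.dz p v) (covDeriv (m := m) N p w) = 0 := by
  have hcomm := hN.levi_dz_mfderiv_comm hS hU hp
  obtain ⟨x, T, s, hT, rfl⟩ := hS.exists_contact_dz_eq p v
  rw [map_add, map_smul, hT, smul_zero, add_zero, hcomm]
  obtain ⟨y, T, s, hT, rfl⟩ := hS.exists_contact_dz_eq p w
  rw [map_add, map_smul, hT, smul_zero, add_zero]
  -- Linearity over ℂ passes from the first slot to the second by symmetry. As the Levi metric is
  -- conjugate linear there, the two terms of ∇_{\bar X} N contribute equally, and the component of
  -- II is exactly minus the pairing.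
  have h1 : levi (S.dz p y) (covDeriv (m := m) N p (S.J p x)) =
      Complex.I * levi (S.dz p y) (covDeriv (m := m) N p x) := by
    rw [hcomm, dz_J, levi_smul_left, hcomm]
  have h2 := hII U N hU hN p hp y x
  have h3 : S.holPart p y = S.dz p y := rfl
  rw [secondFundamentalForm, covDerivBar, h3, levi_smul_right, levi_add_right, levi_smul_right,
    h1] at h2
  simp only [map_div₀, map_one, map_ofNat, Complex.conj_I, ← mul_assoc, neg_mul,
    Complex.I_mul_I, neg_neg, one_mul] at h2
  linear_combination -h2

end PseudohermitianSubmanifold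

/-! ### Levi functionals and smooth solutions of linear systems. -/

namespace Heisenberg

/-- The complex linear functional `levi · c`. -/
noncomputable def leviFunctional {n : ℕ} (c : Fin n → ℂ) : (Fin n → ℂ) →ₗ[ℂ] ℂ where
  toFun w := levi w c
  map_add' a b := levi_add_left a b c
  map_smul' r a := levi_smul_left r a c

theorem leviFunctional_apply {n : ℕ} (w c : Fin n → ℂ) : leviFunctional c w = levi w c := rfl

theorem eq_zero_of_levi_eq_zero {n : ℕ} {c : Fin n → ℂ} (h : ∀ w, levi w c = 0) : c = 0 := by
  funext i
  simpa [levi, Pi.single_apply] using h (Pi.single i 1)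

/-- Conjugation turns orthogonality conditions into a complex linear system, to which Cramer's rule
applies. -/
theorem levi_star {n : ℕ} (w c : Fin n → ℂ) : levi w (star c) = w ⬝ᵥ c := by
  simp [levi, dotProduct]

end Heisenberg

/-- The determinant of a matrix with smooth entries is smooth. -/
theorem ContDiffOn.matrix_det {E : Type*} [NormedAddCommGroup E] [NormedSpace ℝ E] {k : ℕ}
    {D : Set E} {A : E → Matrix (Fin k) (Fin k) ℂ}
    (hA : ∀ i j, ContDiffOn ℝ ∞ (fun u => A u i j) D) :
    ContDiffOn ℝ ∞ (fun u => (A u).det) D := by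
  simp only [Matrix.det_apply]
  refine ContDiffOn.sum fun σ _ => ContDiffOn.const_smul _ ?_
  exact contDiffOn_prod fun i _ => hA _ _

/-- The solution of a linear system with smooth coefficients is smooth. -/
theorem ContDiffOn.matrix_cramer {E : Type*} [NormedAddCommGroup E] [NormedSpace ℝ E] {k : ℕ}
    {D : Set E} {A : E → Matrix (Fin k) (Fin k) ℂ}
    (hA : ∀ i j, ContDiffOn ℝ ∞ (fun u => A u i j) D) (b : Fin k → ℂ)
    (hdet : ∀ u ∈ D, (A u).det ≠ 0) :
    ContDiffOn ℝ ∞ (fun u => ((A u).det)⁻¹ • (A u).cramer b) D := by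
  refine ((ContDiffOn.matrix_det hA).inv hdet).smul (contDiffOn_pi.2 fun i => ?_)
  simp only [Matrix.cramer_apply]
  refine ContDiffOn.matrix_det fun a c => ?_
  by_cases h : c = i
  · simp [h, contDiffOn_const]
  · simpa [Matrix.updateCol_apply, h] using hA a c

/-! ### Codimension one: the horizontal image is parallel. -/

namespace PseudohermitianSubmanifold

open Heisenberg Filter

variable {m : ℕ} {M : Type*} [TopologicalSpace M]
  [ChartedSpace (EuclideanSpace ℝ (Fin (2 * m + 1))) M]
  {S : PseudohermitianSubmanifold m (m + 1) M}

theorem horizontalImage_ne_top (hS : S.IsVertical) (p : M) : horizontalImage hS p ≠ ⊤ := by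
  intro h
  have := finrank_horizontalImage hS p
  rw [h, finrank_top] at this
  simp at this

/-- Orthogonality gives one inclusion, and both spaces have complex dimension m. Hence a nonzero
normal vector determines the horizontal image. -/
theorem horizontalImage_eq_ker (hS : S.IsVertical) {p : M} {c : Fin (m + 1) → ℂ}
    (hc : S.IsNormalAt p c) (hc0 : c ≠ 0) :
    horizontalImage hS p = LinearMap.ker (leviFunctional c) := by
  have hne : leviFunctional c ≠ 0 := fun h =>
    hc0 (eq_zero_of_levi_eq_zero fun w => DFunLike.congr_fun h w)
  refine Submodule.eq_of_le_of_finrank_eq ?_ ?_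
  · rintro _ ⟨v, rfl⟩
    exact hc.levi_dz_eq_zero hS v
  · have h := Module.Dual.finrank_ker_add_one_of_ne_zero hne
    rw [Module.finrank_fin_fun] at h
    rw [finrank_horizontalImage]
    exact (Nat.add_right_cancel h).symm

/-- A vertical submanifold of complex codimension one has local normal fields which are
normalised by a constant vector. -/
theorem IsVertical.exists_isNormalFieldOn [IsManifold (𝓡 (2 * m + 1)) ∞ M] (hS : S.IsVertical)
    (p : M) : ∃ (U : Set M) (N : M → Fin (m + 1) → ℂ) (r : Fin (m + 1) → ℂ), IsOpen U ∧ p ∈ U ∧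
      S.IsNormalFieldOn U N ∧ ∀ q ∈ U, levi r (N q) = 1 := by
  have : IsManifold (𝓡 (2 * m + 1)) 1 M := IsManifold.of_le (n := ∞) (by simp)
  set φ := chartAt (EuclideanSpace ℝ (Fin (2 * m + 1))) p with hφ
  have hp : p ∈ φ.source := mem_chart_source _ p
  let b := Module.finBasisOfFinrankEq ℂ (horizontalImage hS p) (finrank_horizontalImage hS p)
  choose v hv using fun i => mem_horizontalImage.1 (b i).2
  obtain ⟨r, -, hr⟩ := SetLike.exists_of_lt (lt_top_iff_ne_top.2 (horizontalImage_ne_top hS p))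
  -- The first m rows extend a basis of the image at p by keeping its lifts constant in the chart;
  -- the last row is the fixed vector r outside that image. The rows stay independent near p.
  let A : EuclideanSpace ℝ (Fin (2 * m + 1)) → Matrix (Fin (m + 1)) (Fin (m + 1)) ℂ := fun u =>
    Matrix.of (Fin.snoc (α := fun _ => Fin (m + 1) → ℂ)
      (fun i => fderiv ℝ (S.zMap ∘ φ.symm) u (chartDifferential hp (v i))) r)
  have hAinit : ∀ u (i : Fin m), A u i.castSucc =
      fderiv ℝ (S.zMap ∘ φ.symm) u (chartDifferential hp (v i)) := by
    intro u i
    funext j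
    simp only [A, Matrix.of_apply, Fin.snoc_castSucc]
  have hAlast : ∀ u, A u (Fin.last m) = r := by
    intro u
    funext j
    simp only [A, Matrix.of_apply, Fin.snoc_last]
  have hArow : ∀ {q} (hq : q ∈ φ.source) (i : Fin m), A (φ q) i.castSucc =
      S.dz q ((chartDifferential hq).symm (chartDifferential hp (v i))) := by
    intro q hq i
    rw [← S.fderiv_zMap_comp_chartAt_symm hq]
    exact hAinit _ i
  have hAp : (A (φ p)).det ≠ 0 := by
    rw [← isUnit_iff_ne_zero, ← Matrix.isUnit_iff_isUnit_det,
      ← Matrix.linearIndependent_rows_iff_isUnit]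
    have hrow : (A (φ p)).row =
        Fin.snoc (α := fun _ => Fin (m + 1) → ℂ) (fun i => (b i : Fin (m + 1) → ℂ)) r := by
      funext i
      refine Fin.lastCases ?_ (fun i => ?_) i
      · rw [Fin.snoc_last]
        exact hAlast _
      · rw [Fin.snoc_castSucc, ← hv i]
        refine (hArow hp i).trans ?_
        rw [ContinuousLinearEquiv.symm_apply_apply]
    rw [hrow, linearIndependent_finSnoc]
    refine ⟨b.linearIndependent.map' (Submodule.subtype _) (Submodule.ker_subtype _), fun h => hr ?_⟩
    refine Submodule.span_le.2 ?_ h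
    rintro _ ⟨i, rfl⟩
    exact (b i).2
  have hz : ContDiffOn ℝ ∞ (S.zMap ∘ φ.symm) φ.target := by
    intro u hu
    have h := S.contMDiff_zMap.contMDiffOn.contDiffAt_comp_chartAt_symm isOpen_univ
      (φ.map_target hu) trivial
    rw [φ.right_inv hu] at h
    exact h.contDiffWithinAt
  have hA : ∀ i j, ContDiffOn ℝ ∞ (fun u => A u i j) φ.target := by
    intro i j
    refine Fin.lastCases ?_ (fun i => ?_) i
    · simp only [hAlast]
      exact contDiffOn_const
    · simp only [hAinit]
      exact contDiffOn_pi.1 ((hz.fderiv_of_isOpen φ.open_target (m := ∞) (by simp)).clm_apply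
        contDiffOn_const) j
  let D := φ.target ∩ (fun u => (A u).det) ⁻¹' {0}ᶜ
  have hD : IsOpen D := (ContDiffOn.matrix_det hA).continuousOn.isOpen_inter_preimage
    φ.open_target isOpen_compl_singleton
  -- Cramer's solution of A a = e_last: it annihilates the first m rows and pairs to 1 with r. Its
  -- conjugate is the normal field.
  let a : EuclideanSpace ℝ (Fin (2 * m + 1)) → Fin (m + 1) → ℂ := fun u =>
    ((A u).det)⁻¹ • (A u).cramer (Pi.single (Fin.last m) 1)
  have ha : ContDiffOn ℝ ∞ a D := ContDiffOn.matrix_cramer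
    (fun i j => (hA i j).mono Set.inter_subset_left) _ fun u hu => hu.2
  have hAa : ∀ u ∈ D, ∀ i, A u i ⬝ᵥ a u = (Pi.single (Fin.last m) 1 : Fin (m + 1) → ℂ) i := by
    intro u hu i
    have h : (A u).mulVec (a u) = Pi.single (Fin.last m) 1 := by
      have hu' : (A u).det ≠ 0 := hu.2
      rw [Matrix.mulVec_smul, Matrix.mulVec_cramer, smul_smul, inv_mul_cancel₀ hu', one_smul]
    exact congrFun h i
  refine ⟨φ.source ∩ φ ⁻¹' D, fun q => star (a (φ q)), r, φ.isOpen_inter_preimage hD,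
    ⟨hp, φ.map_source hp, hAp⟩, ⟨?_, ?_⟩, ?_⟩
  · have h1 : ContDiffOn ℝ ∞ (fun u => star (a u)) D :=
      contDiffOn_pi.2 fun i => Complex.conjCLE.contDiff.comp_contDiffOn (contDiffOn_pi.1 ha i)
    exact h1.contMDiffOn.comp (contMDiffOn_chart.mono Set.inter_subset_left)
      Set.inter_subset_right
  · rintro q ⟨hq, hqD⟩ y
    have hind : LinearIndependent ℂ fun i : Fin m => A (φ q) i.castSucc := by
      have h : LinearIndependent ℂ (A (φ q)).row := by
        rw [Matrix.linearIndependent_rows_iff_isUnit, Matrix.isUnit_iff_isUnit_det,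
          isUnit_iff_ne_zero]
        exact hqD.2
      exact h.comp _ (Fin.castSucc_injective m)
    -- The m independent rows fill the m-dimensional image at q, so annihilating them suffices for
    -- normality.
    have hspan : Submodule.span ℂ (Set.range fun i : Fin m => A (φ q) i.castSucc) =
        horizontalImage hS q := by
      refine Submodule.eq_of_le_of_finrank_eq (Submodule.span_le.2 ?_) ?_
      · rintro _ ⟨i, rfl⟩
        exact ⟨_, (hArow hq i).symm⟩
      · rw [finrank_span_eq_card hind, finrank_horizontalImage, Fintype.card_fin]
    have hle : horizontalImage hS q ≤ LinearMap.ker (leviFunctional (star (a (φ q)))) := by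
      rw [← hspan]
      refine Submodule.span_le.2 ?_
      rintro _ ⟨i, rfl⟩
      change levi _ _ = 0
      rw [levi_star, hAa _ hqD, Pi.single_eq_of_ne (Fin.castSucc_lt_last i).ne]
    exact hle ⟨y, rfl⟩
  · rintro q ⟨hq, hqD⟩
    rw [levi_star, ← hAlast (φ q), hAa _ hqD, Pi.single_eq_same]

/-- If `II = 0`, the tangent spaces of a vertical hypersurface are locally parallel. -/
theorem SecondFundamentalFormVanishes.isLocallyConstant_horizontalImage
    [IsManifold (𝓡 (2 * m + 1)) ∞ M] (hII : S.SecondFundamentalFormVanishes)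
    (hS : S.IsVertical) : IsLocallyConstant (horizontalImage hS) := by
  have : IsManifold (𝓡 (2 * m + 1)) 1 M := IsManifold.of_le (n := ∞) (by simp)
  refine (IsLocallyConstant.iff_eventually_eq _).2 fun p => ?_
  obtain ⟨U, N, r, hU, hp, hN, hr⟩ := hS.exists_isNormalFieldOn p
  have hker : ∀ q ∈ U, horizontalImage hS q = LinearMap.ker (leviFunctional (N q)) := by
    intro q hq
    refine horizontalImage_eq_ker hS (hN.2 q hq) fun h => ?_
    simpa [h, levi] using hr q hq
  have hdiff : ∀ q ∈ U, MDifferentiableAt (𝓡 (2 * m + 1)) 𝓘(ℝ, Fin (m + 1) → ℂ) N q :=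
    fun q hq => (hN.1.contMDiffAt (hU.mem_nhds hq)).mdifferentiableAt (by simp)
  have hconst : ∀ᶠ q in 𝓝 p, N q = N p := by
    refine eventually_eq_of_mfderiv_eq_zero (E := EuclideanSpace ℝ (Fin (2 * m + 1))) ?_
    filter_upwards [hU.mem_nhds hp] with q hq
    refine ⟨hdiff q hq, ContinuousLinearMap.ext fun v => ?_⟩
    change covDeriv (m := m) N q v = 0
    -- The derivative of the constant ⟨r, N⟩ = 1.
    have hrv : levi r (covDeriv (m := m) N q v) = 0 := by
      have h1 := ((leviBilin (m + 1) r).hasMFDerivAt (x := N q)).comp q (hdiff q hq).hasMFDerivAt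
      have h2 : HasMFDerivAt (𝓡 (2 * m + 1)) 𝓘(ℝ, ℂ) (leviBilin (m + 1) r ∘ N) q 0 :=
        (hasMFDerivAt_const (1 : ℂ) q).congr_of_eventuallyEq
          (Filter.eventually_of_mem (hU.mem_nhds hq) hr)
      exact DFunLike.congr_fun (hasMFDerivAt_unique h1 h2) v
    refine eq_zero_of_levi_eq_zero fun w => ?_
    -- Splits w along the horizontal image and r; the derivative of N is orthogonal to both parts.
    have hw : w - levi w (N q) • r ∈ horizontalImage hS q := by
      rw [hker q hq, LinearMap.mem_ker, map_sub, map_smul, leviFunctional_apply,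
        leviFunctional_apply, hr q hq]
      simp
    obtain ⟨x, hx⟩ := mem_horizontalImage.1 hw
    have h0 := hII.levi_dz_covDeriv_eq_zero hS hU hN hq x v
    rw [hx] at h0
    rw [← sub_add_cancel w (levi w (N q) • r), levi_add_left, levi_smul_left, h0, hrv]
    simp
  filter_upwards [hconst, hU.mem_nhds hp] with q hq hqU
  rw [hker q hqU, hker p hp, hq]

end PseudohermitianSubmanifold

/-! ### Moving the submanifold into the Heisenberg subgroup. -/

namespace Heisenberg

theorem rigidMotionLinear_injective {n : ℕ} (p : Heisenberg n)
    (U : Matrix.unitaryGroup (Fin n) ℂ) : Function.Injective (rigidMotionLinear p.1 U) := by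
  intro q r h
  apply (rigidMotion p U).injective
  rw [rigidMotion_apply, rigidMotion_apply, h]

/-- The projection of `H_{m+1}` onto `H_m` which forgets the last complex coordinate. -/
noncomputable def forgetLast (m : ℕ) : Heisenberg (m + 1) →L[ℝ] Heisenberg m :=
  LinearMap.toContinuousLinearMap
    { toFun := fun q => (fun β => q.1 β.castSucc, q.2)
      map_add' := fun _ _ => rfl
      map_smul' := fun _ _ => rfl }

theorem eq_of_forgetLast_eq {m : ℕ} {q r : Heisenberg (m + 1)}
    (h : forgetLast m q = forgetLast m r) (hl : q.1 (Fin.last m) = r.1 (Fin.last m)) : q = r := by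
  have h1 : ∀ β : Fin m, q.1 β.castSucc = r.1 β.castSucc := congrFun (congrArg Prod.fst h :)
  have h2 : q.2 = r.2 := (congrArg Prod.snd h :)
  refine Prod.ext (funext fun β => ?_) h2
  exact Fin.lastCases hl h1 β

theorem finrank_real_heisenberg (m : ℕ) : Module.finrank ℝ (Heisenberg m) = 2 * m + 1 := by
  rw [Module.finrank_prod, finrank_real_of_complex, Module.finrank_fin_fun, Module.finrank_self]

end Heisenberg

namespace PseudohermitianSubmanifold

open Heisenberg

variable {m : ℕ} {M : Type*} [TopologicalSpace M]
  [ChartedSpace (EuclideanSpace ℝ (Fin (2 * m + 1))) M]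
  {S : PseudohermitianSubmanifold m (m + 1) M}

/-- If the image of `dz` is rotated into `{z_n = 0}` at every point, then a rigid motion takes the
submanifold into `{z_n = 0}`. -/
theorem exists_rigidMotion_last_eq_zero [IsManifold (𝓡 (2 * m + 1)) ∞ M] [ConnectedSpace M]
    {U : Matrix.unitaryGroup (Fin (m + 1)) ℂ}
    (hU : ∀ q v, ((U : Matrix (Fin (m + 1)) (Fin (m + 1)) ℂ).mulVec (S.dz q v)) (Fin.last m) = 0) :
    ∃ p, ∀ q, rigidMotion p U (S.toFun q) ∈ subgroup m := by
  have : IsManifold (𝓡 (2 * m + 1)) 1 M := IsManifold.of_le (n := ∞) (by simp)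
  let L : (Fin (m + 1) → ℂ) →L[ℝ] ℂ := LinearMap.toContinuousLinearMap
    (((LinearMap.proj (Fin.last m)).comp
      (Matrix.mulVecLin (U : Matrix (Fin (m + 1)) (Fin (m + 1)) ℂ))).restrictScalars ℝ)
  have hL : ∀ w, L w = ((U : Matrix (Fin (m + 1)) (Fin (m + 1)) ℂ).mulVec w) (Fin.last m) :=
    fun _ => rfl
  have hloc : IsLocallyConstant (L ∘ S.zMap) := by
    refine (IsLocallyConstant.iff_eventually_eq _).2 fun p => ?_
    refine eventually_eq_of_mfderiv_eq_zero (E := EuclideanSpace ℝ (Fin (2 * m + 1)))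
      (Filter.Eventually.of_forall fun q => ?_)
    have h := (L.hasMFDerivAt (x := S.zMap q)).comp q
      ((S.contMDiff_zMap q).mdifferentiableAt (by simp)).hasMFDerivAt
    refine ⟨h.mdifferentiableAt, h.mfderiv.trans (ContinuousLinearMap.ext fun v => ?_)⟩
    rw [mfderiv_zMap]
    exact hU q v
  obtain ⟨p₀⟩ := (inferInstance : Nonempty M)
  -- Translation adds its z-part, so this choice cancels the constant last coordinate of U z; the
  -- t-part plays no role.
  refine ⟨(-((U : Matrix (Fin (m + 1)) (Fin (m + 1)) ℂ).mulVec (S.zMap p₀)), 0), fun q => ?_⟩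
  have h := hloc.apply_eq_of_preconnectedSpace q p₀
  simp only [Function.comp_apply, hL] at h
  change (rigidMotion _ U (S.toFun q)).1 (Fin.last m) = 0
  rw [rigidMotion_apply, rigidMotionLinear_apply]
  simp only [Prod.fst_add, Pi.add_apply, Pi.neg_apply]
  rw [← h]
  exact neg_add_cancel _

/-- A submanifold that a rigid motion takes into `{z_n = 0}` is openly embedded in there. -/
theorem isOpenEmbedding_forgetLast_rigidMotion [IsManifold (𝓡 (2 * m + 1)) ∞ M]
    {U : Matrix.unitaryGroup (Fin (m + 1)) ℂ} {p : Heisenberg (m + 1)}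
    (hU : ∀ q v, ((U : Matrix (Fin (m + 1)) (Fin (m + 1)) ℂ).mulVec (S.dz q v)) (Fin.last m) = 0)
    (hp : ∀ q, rigidMotion p U (S.toFun q) ∈ subgroup m) :
    Topology.IsOpenEmbedding fun q => forgetLast m (rigidMotion p U (S.toFun q)) := by
  have hk : ContMDiff (𝓡 (2 * m + 1)) 𝓘(ℝ, Heisenberg m) ∞
      fun q => forgetLast m (rigidMotion p U (S.toFun q)) :=
    ((forgetLast m).contDiff.comp (contDiff_rigidMotion p U)).contMDiff.comp S.smooth
  refine .of_continuous_injective_isOpenMap hk.continuous (fun q r h => S.injective ?_) ?_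
  · exact (rigidMotion p U).injective (eq_of_forgetLast_eq h ((hp q).trans (hp r).symm))
  · refine hk.isOpenMap_of_mfderiv_surjective (E := EuclideanSpace ℝ (Fin (2 * m + 1)))
      fun q => ?_
    have hd : HasMFDerivAt (𝓡 (2 * m + 1)) 𝓘(ℝ, Heisenberg m)
        (fun q => forgetLast m (rigidMotion p U (S.toFun q))) q
        (((forgetLast m).comp (rigidMotionLinear p.1 U)).comp (tangentMapAt m S.toFun q)) :=
      ((forgetLast m).hasFDerivAt.comp _
        (hasFDerivAt_rigidMotion p U (S.toFun q))).hasMFDerivAt.comp q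
        ((S.smooth q).mdifferentiableAt (by simp)).hasMFDerivAt
    rw [hd.mfderiv]
    have hfin : Module.finrank ℝ (TangentSpace (𝓡 (2 * m + 1)) q) = 2 * m + 1 :=
      finrank_euclideanSpace_fin
    have : FiniteDimensional ℝ (TangentSpace (𝓡 (2 * m + 1)) q) :=
      inferInstanceAs (FiniteDimensional ℝ (EuclideanSpace ℝ (Fin (2 * m + 1))))
    let D : TangentSpace (𝓡 (2 * m + 1)) q →ₗ[ℝ] Heisenberg m :=
      (((forgetLast m).comp (rigidMotionLinear p.1 U)).comp
        (tangentMapAt m S.toFun q)).toLinearMap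
    -- Forgetting the last coordinate loses nothing, since it vanishes on the rotated tangent
    -- vectors. Equal dimensions 2m + 1 then turn injectivity into surjectivity.
    have hinj : Function.Injective D := by
      intro v w h
      refine S.immersion q (rigidMotionLinear_injective p U (eq_of_forgetLast_eq h ?_))
      exact (hU q v).trans (hU q w).symm
    exact (LinearMap.injective_iff_surjective_of_finrank_eq_finrank
      (hfin.trans (finrank_real_heisenberg m).symm)).1 hinj

end PseudohermitianSubmanifold

/-! ### Conclusion. -/

theorem theoremC (m : ℕ) (hm : 1 ≤ m) (M : Type*) [TopologicalSpace M]
    [ChartedSpace (EuclideanSpace ℝ (Fin (2 * m + 1))) M]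
    [IsManifold (𝓡 (2 * m + 1)) ∞ M] [SimplyConnectedSpace M]
    (S : PseudohermitianSubmanifold m (m + 1) M)
    (hvertical : S.IsVertical) (hII : S.SecondFundamentalFormVanishes) :
    Topology.IsEmbedding S.toFun ∧
      ∃ Φ : Heisenberg (m + 1) ≃ Heisenberg (m + 1), Heisenberg.IsRigidMotion Φ ∧
        ∃ V : Set (Heisenberg (m + 1)), IsOpen V ∧
          Φ '' Set.range S.toFun = V ∩ Heisenberg.subgroup m := by
  obtain ⟨p₀⟩ := (inferInstance : Nonempty M)
  obtain ⟨U, hW⟩ := Heisenberg.exists_unitary_mulVec_last_eq_zero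
    (S.horizontalImage_ne_top hvertical p₀)
  have hU : ∀ q v, ((U : Matrix (Fin (m + 1)) (Fin (m + 1)) ℂ).mulVec (S.dz q v))
      (Fin.last m) = 0 := by
    intro q v
    refine hW _ ?_
    rw [(hII.isLocallyConstant_horizontalImage hvertical).apply_eq_of_preconnectedSpace p₀ q]
    exact ⟨v, rfl⟩
  obtain ⟨p, hp⟩ := S.exists_rigidMotion_last_eq_zero hU
  have hk := S.isOpenEmbedding_forgetLast_rigidMotion hU hp
  have hΦ : Continuous fun x => Heisenberg.forgetLast m (Heisenberg.rigidMotion p U x) :=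
    (Heisenberg.forgetLast m).continuous.comp (Heisenberg.contDiff_rigidMotion p U).continuous
  -- The inclusion is an embedding because its composite with a continuous map is one. The open set
  -- is the cylinder over the open image in H_m, which meets {z_n = 0} exactly in the moved
  -- submanifold.
  refine ⟨.of_comp S.smooth.continuous hΦ hk.isEmbedding,
    Heisenberg.rigidMotion p U, Heisenberg.isRigidMotion_rigidMotion p U,
    Heisenberg.forgetLast m ⁻¹' Set.range fun q =>
      Heisenberg.forgetLast m (Heisenberg.rigidMotion p U (S.toFun q)),
    hk.isOpen_range.preimage (Heisenberg.forgetLast m).continuous, ?_⟩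
  ext x
  constructor
  · rintro ⟨_, ⟨q, rfl⟩, rfl⟩
    exact ⟨⟨q, rfl⟩, hp q⟩
  · rintro ⟨⟨q, hq⟩, hx⟩
    exact ⟨_, ⟨q, rfl⟩, Heisenberg.eq_of_forgetLast_eq hq ((hp q).trans hx.symm)⟩
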